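/- Let $\mathbb K$ be a field, $n\ge 0$, and let $I$ be an ideal of $\mathbb K[x_1,\dots,x_n]$. A monomial ordering is a well-ordering $<$ of the set of monomials $x_1^{i_1}\cdots x_n^{i_n}$ (identified with $\mathbb Z_{\ge 0}^n$) such that $a<b$ implies $ca<cb$ for all monomials $a,b,c$. For a monomial ordering and a nonzero polynomial $f$, let $LM(f)$ be the largest monomial occurring in $f$ with nonzero coefficient, and let $LM(I)$ be the ideal generated by all $LM(f)$ with $0\ne f\in I$ (so $LM(0)=0$ for the zero ideal). A subset $G\subseteq I$ is a Gröbner basis of $I$ with respect to the ordering if the monomials $LM(g)$, $0\neq g\in G$, generate the ideal $LM(I)$. Theorem. There exists a finite set $\{f_1,\dots,f_s\}\subseteq I$ which is a Gröbner basis of $I$ with respect to every monomial ordering simultaneously (a universal Gröbner basis of $I$). -/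

import Mathlib

universe u v

namespace UniversalGroebner

/-- The leading monomial of a polynomial `f` with respect to the monomial ordering `m`:
the `m`-largest monomial occurring in `f`, with coefficient `1`.
It is only meaningful for `f ≠ 0`. -/
noncomputable def leadingMonomial {σ : Type*} {K : Type*} [Field K] (m : MonomialOrder σ)
    (f : MvPolynomial σ K) : MvPolynomial σ K :=
  MvPolynomial.monomial (m.degree f) 1

/-- The ideal generated by the leading monomials of the nonzero polynomials in `S`. -/
noncomputable def leadingMonomialIdeal {σ : Type*} {K : Type*} [Field K] (m : MonomialOrder σ)
    (S : Set (MvPolynomial σ K)) : Ideal (MvPolynomial σ K) :=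
  Ideal.span {p | ∃ f ∈ S, f ≠ 0 ∧ p = leadingMonomial m f}

/-- `G` is a Gröbner basis of the ideal `I` with respect to `m`: it is a subset of `I`, and the
leading monomials of its nonzero elements generate the ideal of leading monomials of `I`. -/
def IsGroebnerBasis {σ : Type*} {K : Type*} [Field K] (m : MonomialOrder σ)
    (I : Ideal (MvPolynomial σ K)) (G : Set (MvPolynomial σ K)) : Prop :=
  G ⊆ (I : Set (MvPolynomial σ K)) ∧
    leadingMonomialIdeal m G = leadingMonomialIdeal m (I : Set (MvPolynomial σ K))

end UniversalGroebner

/-!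
The key idea is that the monomial orderings form a compact space. Along an ultrafilter `U` of
monomial orderings they converge to the ordering `a ≤ b ↔ ∀ᶠ m in U, a ≤ b for m`, which is again a
well-ordering by Dickson's lemma. If `G` is a finite Gröbner basis for the limit, then `U`-almost
all orderings select the same leading monomials on `G` as the limit does. By Macaulay's criterion,
whether `G` is a Gröbner basis depends only on these leading monomials, so `G` is a Gröbner basis
for `U`-almost every ordering. Compactness of the space of ultrafilters then yields finitely many
finite sets, one of which works for each ordering, and their union works for all of them.
-/

namespace UniversalGroebner

open MvPolynomial Filter MonomialOrder

lemma exists_finset_forall_of_forall_ultrafilter {α ι : Type*} {p : ι → α → Prop}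
    (h : ∀ U : Ultrafilter α, ∃ i, ∀ᶠ a in U, p i a) :
    ∃ s : Finset ι, ∀ a, ∃ i ∈ s, p i a := by
  obtain ⟨s, hs⟩ := isCompact_univ.elim_finite_subcover
    (fun i ↦ {U : Ultrafilter α | {a | p i a} ∈ U}) (fun _ ↦ ultrafilter_isOpen_basic _)
    fun U _ ↦ Set.mem_iUnion.2 (h U)
  refine ⟨s, fun a ↦ ?_⟩
  simpa using hs (Set.mem_univ (pure a))

lemma exists_finset_subset_forall_exists_le {α : Type*} [PartialOrder α] [WellQuasiOrderedLE α]
    (S : Set α) : ∃ t : Finset α, ↑t ⊆ S ∧ ∀ a ∈ S, ∃ b ∈ t, b ≤ a := by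
  have hfin : {b | Minimal (· ∈ S) b}.Finite :=
    WellQuasiOrderedLE.finite_of_isAntichain (setOfPred_minimal_antichain (· ∈ S))
  refine ⟨hfin.toFinset, fun b hb ↦ (hfin.mem_toFinset.1 hb).prop, fun a ha ↦ ?_⟩
  obtain ⟨b, hba, hb⟩ := exists_minimal_le_of_wellFoundedLT (· ∈ S) a ha
  exact ⟨b, hfin.mem_toFinset.2 hb, hba⟩

section Ultralimit

variable {σ : Type*}

/-- The exponents, as a type synonym carrying the limit along `U` of the monomial orderings: `a ≤ b`
holds in the limit if it holds for `U`-almost every ordering. -/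
def UltralimitSyn (_U : Ultrafilter (MonomialOrder σ)) : Type _ := σ →₀ ℕ

namespace UltralimitSyn

variable {U : Ultrafilter (MonomialOrder σ)}

noncomputable instance : AddCommMonoid (UltralimitSyn U) :=
  inferInstanceAs (AddCommMonoid (σ →₀ ℕ))

variable (U) in
/-- The identity map from exponents to the synonym that carries the limit ordering. -/
noncomputable def ofExponent : (σ →₀ ℕ) ≃+ UltralimitSyn U := AddEquiv.refl _

noncomputable instance : LinearOrder (UltralimitSyn U) where
  le a b := ∀ᶠ m in U, (ofExponent U).symm a ≼[m] (ofExponent U).symm b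
  le_refl _ := Eventually.of_forall fun _ ↦ le_rfl
  le_trans _ _ _ hab hbc := by filter_upwards [hab, hbc] with m using le_trans
  le_antisymm a b hab hba := by
    obtain ⟨m, hm_ab, hm_ba⟩ := (hab.and hba).exists
    exact m.toSyn.injective (le_antisymm hm_ab hm_ba)
  le_total _ _ := Ultrafilter.eventually_or.1 (Eventually.of_forall fun _ ↦ le_total _ _)
  toDecidableLE := Classical.decRel _

lemma ofExponent_le_ofExponent {a b : σ →₀ ℕ} :
    ofExponent U a ≤ ofExponent U b ↔ ∀ᶠ m in U, a ≼[m] b :=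
  Iff.rfl

lemma monotone_ofExponent : Monotone (ofExponent U) := fun _ _ hab ↦
  ofExponent_le_ofExponent.2 (Eventually.of_forall fun m ↦ m.toSyn_monotone hab)

instance : IsOrderedAddMonoid (UltralimitSyn U) where
  add_le_add_left a b hab c := by
    filter_upwards [hab] with m hm
    simpa only [map_add] using add_le_add_left hm _

instance [Finite σ] : WellFoundedLT (UltralimitSyn U) :=
  have : WellQuasiOrderedLE (UltralimitSyn U) :=
    monotone_ofExponent.wellQuasiOrderedLE_of_wellQuasiOrderedLE_of_surjective
      (ofExponent U).surjective
  inferInstance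

end UltralimitSyn

open UltralimitSyn

/-- The limit along the ultrafilter `U` of the monomial orderings in finitely many variables. -/
noncomputable def ultralimit [Finite σ] (U : Ultrafilter (MonomialOrder σ)) : MonomialOrder σ where
  syn := UltralimitSyn U
  toSyn := ofExponent U
  toSyn_monotone := monotone_ofExponent

lemma ultralimit_le_iff [Finite σ] {U : Ultrafilter (MonomialOrder σ)} {a b : σ →₀ ℕ} :
    a ≼[ultralimit U] b ↔ ∀ᶠ m in U, a ≼[m] b :=
  ofExponent_le_ofExponent

lemma eventually_degree_eq_degree_ultralimit [Finite σ] {R : Type*} [CommSemiring R]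
    (U : Ultrafilter (MonomialOrder σ)) (f : MvPolynomial σ R) :
    ∀ᶠ m : MonomialOrder σ in U, m.degree f = (ultralimit U).degree f := by
  obtain rfl | hf := eq_or_ne f 0
  · simp only [degree_zero, eventually_true]
  have hsupport : ∀ᶠ m in U, ∀ c ∈ f.support, c ≼[m] (ultralimit U).degree f :=
    (Finset.eventually_all _).2 fun c hc ↦ ultralimit_le_iff.1 ((ultralimit U).le_degree hc)
  filter_upwards [hsupport] with m hm
  exact m.toSyn.injective <|
    le_antisymm (hm _ (degree_mem_support hf)) (m.le_degree (degree_mem_support hf))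

end Ultralimit

lemma exists_degree_eq_degree_sum {σ R ι : Type*} [CommSemiring R] {m : MonomialOrder σ}
    {s : Finset ι} {p : ι → MvPolynomial σ R} (hne : ∑ i ∈ s, p i ≠ 0)
    (hle : ∀ i ∈ s, m.degree (p i) ≼[m] m.degree (∑ i ∈ s, p i)) :
    ∃ i ∈ s, p i ≠ 0 ∧ m.degree (p i) = m.degree (∑ i ∈ s, p i) := by
  have hcoeff : ∑ i ∈ s, coeff (m.degree (∑ i ∈ s, p i)) (p i) ≠ 0 := by
    simpa only [coeff_sum] using m.coeff_degree_ne_zero_iff.2 hne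
  obtain ⟨i, hi, hci⟩ := Finset.exists_ne_zero_of_sum_ne_zero hcoeff
  refine ⟨i, hi, fun h ↦ hci (by rw [h, coeff_zero]), ?_⟩
  exact m.toSyn.injective (le_antisymm (hle i hi) (m.le_degree (mem_support_iff.2 hci)))

section GroebnerBasis

variable {σ K : Type*} [Field K] {m : MonomialOrder σ} {I : Ideal (MvPolynomial σ K)}
  {G H S T : Set (MvPolynomial σ K)}

lemma leadingMonomialIdeal_eq_span_image (m : MonomialOrder σ) (S : Set (MvPolynomial σ K)) :
    leadingMonomialIdeal m S =
      Ideal.span ((fun d ↦ monomial d (1 : K)) '' (m.degree '' (S \ {0}))) := by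
  rw [leadingMonomialIdeal, Set.image_image]
  congr 1
  ext p
  simp only [leadingMonomial, Set.mem_ofPred_eq, Set.mem_image, Set.mem_sdiff,
    Set.mem_singleton_iff, and_assoc, eq_comm]

lemma leadingMonomial_mem_leadingMonomialIdeal_iff {f : MvPolynomial σ K} :
    leadingMonomial m f ∈ leadingMonomialIdeal m S ↔
      ∃ g ∈ S, g ≠ 0 ∧ m.degree g ≤ m.degree f := by
  classical
  rw [leadingMonomialIdeal_eq_span_image, mem_ideal_span_monomial_image, leadingMonomial,
    support_monomial, if_neg one_ne_zero]
  simp only [Finset.mem_singleton, forall_eq, Set.exists_mem_image, Set.mem_sdiff,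
    Set.mem_singleton_iff, and_assoc]

lemma leadingMonomialIdeal_le_iff :
    leadingMonomialIdeal m S ≤ leadingMonomialIdeal m T ↔
      ∀ f ∈ S, f ≠ 0 → ∃ g ∈ T, g ≠ 0 ∧ m.degree g ≤ m.degree f := by
  simp only [← leadingMonomial_mem_leadingMonomialIdeal_iff]
  refine Ideal.span_le.trans ⟨fun h f hf hf0 ↦ h ⟨f, hf, hf0, rfl⟩, ?_⟩
  rintro h _ ⟨f, hf, hf0, rfl⟩
  exact h f hf hf0

lemma isGroebnerBasis_iff_exists_degree_le :
    IsGroebnerBasis m I G ↔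
      G ⊆ I ∧ ∀ f ∈ I, f ≠ 0 → ∃ g ∈ G, g ≠ 0 ∧ m.degree g ≤ m.degree f := by
  refine and_congr_right fun hGI ↦ ?_
  have hle : leadingMonomialIdeal m G ≤ leadingMonomialIdeal m I :=
    Ideal.span_mono fun _ ⟨g, hg, hp⟩ ↦ ⟨g, hGI hg, hp⟩
  rw [hle.ge_iff_eq.symm, leadingMonomialIdeal_le_iff]
  rfl

lemma IsGroebnerBasis.mono (hG : IsGroebnerBasis m I G) (hGH : G ⊆ H) (hHI : H ⊆ I) :
    IsGroebnerBasis m I H := by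
  rw [isGroebnerBasis_iff_exists_degree_le] at hG ⊢
  refine ⟨hHI, fun f hf hf0 ↦ ?_⟩
  obtain ⟨g, hg, hgf⟩ := hG.2 f hf hf0
  exact ⟨g, hGH hg, hgf⟩

lemma exists_finset_isGroebnerBasis [Finite σ] (m : MonomialOrder σ)
    (I : Ideal (MvPolynomial σ K)) :
    ∃ G : Finset (MvPolynomial σ K), 0 ∉ G ∧ IsGroebnerBasis m I G := by
  classical
  obtain ⟨t, ht, hle⟩ :=
    exists_finset_subset_forall_exists_le (m.degree '' ((I : Set (MvPolynomial σ K)) \ {0}))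
  obtain ⟨G, hGI, rfl⟩ := Finset.subset_set_image_iff.1 ht
  refine ⟨G, fun h0 ↦ (hGI h0).2 rfl, isGroebnerBasis_iff_exists_degree_le.2
    ⟨fun g hg ↦ (hGI hg).1, fun f hf hf0 ↦ ?_⟩⟩
  obtain ⟨_, hd, hdf⟩ := hle _ ⟨f, ⟨hf, hf0⟩, rfl⟩
  obtain ⟨g, hg, rfl⟩ := Finset.mem_image.1 hd
  exact ⟨g, hg, (hGI hg).2, hdf⟩

lemma exists_degree_le_of_forall_exists_mem_support (h0 : 0 ∉ G) (hGI : G ⊆ I)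
    (hred : ∀ r ∈ I, r ≠ 0 → ∃ c ∈ r.support, ∃ g ∈ G, m.degree g ≤ c)
    {f : MvPolynomial σ K} (hf : f ∈ I) (hf0 : f ≠ 0) : ∃ g ∈ G, m.degree g ≤ m.degree f := by
  obtain ⟨q, r, hfqr, hdeg, hr⟩ := m.div_set (B := G)
    (fun g hg ↦ (m.leadingCoeff_ne_zero_iff.2 (ne_of_mem_of_not_mem hg h0)).isUnit) f
  have hsum : Finsupp.linearCombination _ (fun g : G ↦ (g : MvPolynomial σ K)) q =
      ∑ g ∈ q.support, (g : MvPolynomial σ K) * q g := by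
    simp only [Finsupp.linearCombination_apply, Finsupp.sum, smul_eq_mul, mul_comm]
  rw [hsum] at hfqr
  have hrI : r ∈ I := by
    refine (I.add_mem_iff_right (I.sum_mem fun g _ ↦ ?_)).1 (hfqr ▸ hf)
    exact I.mul_mem_right _ (hGI g.2)
  obtain rfl : r = 0 := by
    by_contra hr0
    obtain ⟨c, hc, g, hg, hgc⟩ := hred r hrI hr0
    exact hr c hc g hg hgc
  rw [add_zero] at hfqr
  subst hfqr
  obtain ⟨g, -, hgq, hg⟩ := exists_degree_eq_degree_sum hf0 fun g _ ↦ hdeg g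
  refine ⟨g, g.2, ?_⟩
  rw [← hg, m.degree_mul' hgq]
  exact le_self_add

/-- Macaulay's criterion, in the form: no nonzero element of `I` is a combination of standard
monomials. The ordering enters the right-hand side only through the leading exponents of `G`. -/
lemma isGroebnerBasis_iff_exists_mem_support (h0 : 0 ∉ G) :
    IsGroebnerBasis m I G ↔
      G ⊆ I ∧ ∀ f ∈ I, f ≠ 0 → ∃ c ∈ f.support, ∃ g ∈ G, m.degree g ≤ c := by
  rw [isGroebnerBasis_iff_exists_degree_le]
  refine and_congr_right fun hGI ↦ ⟨fun h f hf hf0 ↦ ?_, fun h f hf hf0 ↦ ?_⟩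
  · obtain ⟨g, hg, -, hgf⟩ := h f hf hf0
    exact ⟨m.degree f, degree_mem_support hf0, g, hg, hgf⟩
  · obtain ⟨g, hg, hgf⟩ := exists_degree_le_of_forall_exists_mem_support h0 hGI h hf hf0
    exact ⟨g, hg, ne_of_mem_of_not_mem hg h0, hgf⟩

lemma IsGroebnerBasis.of_degree_eq {m' : MonomialOrder σ} (hG : IsGroebnerBasis m I G)
    (h0 : 0 ∉ G) (hdeg : ∀ g ∈ G, m'.degree g = m.degree g) : IsGroebnerBasis m' I G := by
  rw [isGroebnerBasis_iff_exists_mem_support h0] at hG ⊢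
  refine ⟨hG.1, fun f hf hf0 ↦ ?_⟩
  obtain ⟨c, hc, g, hg, hgc⟩ := hG.2 f hf hf0
  exact ⟨c, hc, g, hg, (hdeg g hg).trans_le hgc⟩

lemma exists_finset_eventually_isGroebnerBasis [Finite σ] (I : Ideal (MvPolynomial σ K))
    (U : Ultrafilter (MonomialOrder σ)) :
    ∃ G : Finset (MvPolynomial σ K), ∀ᶠ m in U, IsGroebnerBasis m I G := by
  obtain ⟨G, h0, hG⟩ := exists_finset_isGroebnerBasis (ultralimit U) I
  have hdeg : ∀ᶠ m : MonomialOrder σ in U, ∀ g ∈ G, m.degree g = (ultralimit U).degree g :=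
    (Finset.eventually_all _).2 fun g _ ↦ eventually_degree_eq_degree_ultralimit U g
  exact ⟨G, hdeg.mono fun m hm ↦ hG.of_degree_eq h0 hm⟩

end GroebnerBasis

end UniversalGroebner

open UniversalGroebner in
theorem mainTheorem3_general {σ K : Type*} [Finite σ] [Field K] (I : Ideal (MvPolynomial σ K)) :
    ∃ G : Finset (MvPolynomial σ K), ∀ m : MonomialOrder σ, IsGroebnerBasis m I G := by
  classical
  obtain ⟨s, hs⟩ := exists_finset_forall_of_forall_ultrafilter
    (exists_finset_eventually_isGroebnerBasis I)
  refine ⟨(s.biUnion id).filter (· ∈ I), fun m ↦ ?_⟩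
  obtain ⟨G, hGs, hG⟩ := hs m
  refine hG.mono (fun g hg ↦ ?_) fun g hg ↦ (Finset.mem_filter.1 hg).2
  exact Finset.mem_filter.2 ⟨Finset.mem_biUnion.2 ⟨G, hGs, hg⟩, hG.1 hg⟩

theorem mainTheorem3 {K : Type u} [Field K] (n : ℕ) (I : Ideal (MvPolynomial (Fin n) K)) :
    ∃ G : Finset (MvPolynomial (Fin n) K), ∀ m : MonomialOrder.{0, v} (Fin n),
      UniversalGroebner.IsGroebnerBasis m I (G : Set (MvPolynomial (Fin n) K)) :=
  mainTheorem3_general I
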